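/- Let $G$ be a finite simple graph that is cubic (every vertex has exactly three neighbors) and triangle-free. A set $D$ of vertices of $G$ is a dissociation set if the subgraph of $G$ induced by $D$ has maximum degree at most $1$. Let $\mathrm{diss}(G)$ be the maximum order of a dissociation set in $G$, and let $\alpha(G)$ be the independence number of $G$, the maximum order of a set of pairwise non-adjacent vertices. Then $$\alpha(G)\ \geq\ \frac{5}{8}\,\mathrm{diss}(G).$$ -/

import Mathlib

namespace SimpleGraph

/-- A set `D` of vertices is a dissociation set in `G` if the subgraph of `G` induced by `D`
has maximum degree at most `1`, that is, each of its vertices has at most one neighbor in it. -/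
def IsDissociationSet {V : Type*} (G : SimpleGraph V) (D : Set V) : Prop :=
  ∀ v : D, ((G.induce D).neighborSet v).encard ≤ 1

/-- The dissociation number of `G`: the maximum order of a (finite) dissociation set in `G`. -/
noncomputable def dissNum {V : Type*} (G : SimpleGraph V) : ℕ :=
  sSup {n | ∃ D : Finset V, G.IsDissociationSet (D : Set V) ∧ D.card = n}

end SimpleGraph

/-!
Let `D` be a maximum dissociation set and, among these, one with as many isolated vertices as
possible. Then every vertex outside `D` has at least two neighbors in `D`
(`exists_dissociation_dominating`), so the complement `R` of `D` is a dissociation set too. Call the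
two ends of an edge inside `D` a pair.

A dissociation set `X` with `k` non-isolated vertices contains an independent set of order
`|X| - k / 2` (`exists_isIndepSet_of_dissociation`). For `X = R` this gives a first lower bound
on `α`.

For the second one, let `A` be the set of isolated vertices of `D`, and let `U` be the set of
vertices of `R` without a neighbor in `A`. An independent `T ⊆ U` extends by `A` and by one end of
every pair that has an end without neighbors in `T`
(`exists_isIndepSet_of_blocked`). Only pairs with both ends adjacent to `T` are lost, and the claim
is that `T` exists with `|T| - (lost pairs) ≥ |U| / 6` (`exists_subset_blocked`). Two vertices of `U`
conflict if they are adjacent or adjacent to different ends of one pair; each has at most six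
conflicts. While some vertex has at most five among the remaining ones, it is taken greedily and
its conflicts are removed. If every vertex of the remaining set `S` has six, then `S` and the pairs
it touches are closed under adjacency, `S` is independent, and a count of edges shows that `S`
loses only `3 |S| / 4` pairs, so all of `S` is taken.

Counting the edges between `D` and `R` relates the orders involved, and a linear combination of
the two bounds gives `8 α ≥ 5 |D|`.
-/

namespace SimpleGraph

open Finset

/-! ### Independent subsets of dissociation sets -/

open scoped Classical in
/-- A dissociation set contains an independent set missing at most half of its non-isolated
vertices: one end of each edge is dropped. -/
theorem exists_isIndepSet_of_dissociation {V : Type*} [Fintype V] (G : SimpleGraph V)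
    (X : Finset V) (hX : ∀ x ∈ X, ∀ y ∈ X, ∀ z ∈ X, G.Adj x y → G.Adj x z → y = z) :
    ∃ I ⊆ X, G.IsIndepSet (I : Set V) ∧ 2 * #X ≤ 2 * #I + #{x ∈ X | ∃ y ∈ X, G.Adj x y} := by
  -- of the two ends of an edge, the one with the smaller label is kept
  let f := Fintype.equivFin V
  refine ⟨{x ∈ X | ∀ y ∈ X, G.Adj x y → f x < f y}, filter_subset _ _, ?_, ?_⟩
  · intro x hx y hy _ hxy
    simp only [coe_filter, Set.mem_ofPred_eq] at hx hy
    exact lt_asymm (hx.2 y hy.1 hxy) (hy.2 x hx.1 hxy.symm)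
  · set I := {x ∈ X | ∀ y ∈ X, G.Adj x y → f x < f y} with hI
    set X₁ := {x ∈ X | ∃ y ∈ X, G.Adj x y} with hX₁
    have h1 : #I + #(X \ I) = #X := by
      rw [add_comm]; exact card_sdiff_add_card_eq_card (filter_subset _ _)
    have h2 : #(X₁ ∩ I) + #(X \ I) = #X₁ := by
      have : X \ I = X₁ \ I := by
        ext x
        simp only [hI, hX₁, mem_sdiff, mem_filter]
        constructor
        · rintro ⟨hx, hn⟩
          refine ⟨⟨hx, ?_⟩, hn⟩
          by_contra! hc
          exact hn ⟨hx, fun y hy hxy => absurd hxy (hc y hy)⟩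
        · rintro ⟨hx, hn⟩
          exact ⟨hx.1, hn⟩
      rw [this]; exact card_inter_add_card_sdiff X₁ I
    -- the larger end of an edge is sent to the smaller one
    have h3 : #(X \ I) ≤ #(X₁ ∩ I) := by
      have key : ∀ x ∈ X \ I, ∃ y ∈ X, G.Adj x y ∧ f y < f x := by
        intro x hx
        simp only [hI, mem_sdiff, mem_filter, not_and, not_forall] at hx
        obtain ⟨hx, hn⟩ := hx
        obtain ⟨y, hy, hxy, hlt⟩ := hn hx
        exact ⟨y, hy, hxy, lt_of_le_of_ne (not_lt.1 hlt)
          fun h => hxy.ne (f.injective h).symm⟩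
      choose! p hp using key
      refine card_le_card_of_injOn p ?_ ?_
      · intro x hx
        obtain ⟨hy, hxy, hlt⟩ := hp x hx
        have hxX := (mem_sdiff.1 hx).1
        simp only [hI, hX₁, coe_inter, coe_filter, Set.mem_inter_iff, Set.mem_ofPred_eq]
        refine ⟨⟨hy, x, hxX, hxy.symm⟩, hy, fun z hz hz' => ?_⟩
        rwa [hX _ hy z hz x hxX hz' hxy.symm]
      · intro x hx x' hx' he
        obtain ⟨hy, hxy, -⟩ := hp x hx
        obtain ⟨-, hxy', -⟩ := hp x' hx'
        rw [← he] at hxy'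
        exact hX _ hy x (mem_sdiff.1 hx).1 x' (mem_sdiff.1 hx').1 hxy.symm hxy'.symm
    omega

/-! ### Extending a set by ends of pairs -/

open scoped Classical in
/-- The pairs of `D` blocked by `T`, as the set of their vertices: both ends have a neighbor
in `T`, so neither can be added to `T`. -/
noncomputable def blocked {V : Type*} (G : SimpleGraph V) (D T : Finset V) : Finset V :=
  {a ∈ D | ∃ b ∈ D, G.Adj a b ∧ (∃ t ∈ T, G.Adj t a) ∧ ∃ t ∈ T, G.Adj t b}

open scoped Classical in
/-- An independent set `T` with no neighbor among the isolated vertices of `D` extends by those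
vertices and by one end of every pair that is not blocked. The bound is doubled because `blocked`
counts vertices, two for each pair. -/
theorem exists_isIndepSet_of_blocked {V : Type*} [Fintype V] (G : SimpleGraph V)
    (D T : Finset V) (hD : ∀ x ∈ D, ∀ y ∈ D, ∀ z ∈ D, G.Adj x y → G.Adj x z → y = z)
    (hT : G.IsIndepSet (T : Set V)) (hdisj : Disjoint D T)
    (hiso : ∀ t ∈ T, ∀ a ∈ D, G.Adj t a → ∃ b ∈ D, G.Adj a b) :
    ∃ I : Finset V, G.IsIndepSet (I : Set V) ∧
      2 * #T + #D + #{a ∈ D | ∀ b ∈ D, ¬ G.Adj a b} ≤ 2 * #I + #(blocked G D T) := by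
  -- the free vertices: those of `D` without neighbors in `T`
  set F := {a ∈ D | ∀ t ∈ T, ¬ G.Adj t a} with hF
  have hTT : ∀ x ∈ T, ∀ y ∈ T, ¬ G.Adj x y := fun x hx y hy h => hT hx hy h.ne h
  have hFD : F ⊆ D := filter_subset _ _
  have hFT : ∀ x ∈ T, ∀ y ∈ F, ¬ G.Adj x y := fun x hx y hy => (mem_filter.1 hy).2 x hx
  obtain ⟨I, -, hI, hc⟩ := exists_isIndepSet_of_dissociation G (T ∪ F) (by
    intro x hx y hy z hz hxy hxz
    rcases mem_union.1 hx with hx | hx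
    · rcases mem_union.1 hy with hy | hy
      · exact absurd hxy (hTT x hx y hy)
      · exact absurd hxy (hFT x hx y hy)
    · rcases mem_union.1 hy with hy | hy
      · exact absurd hxy.symm (hFT y hy x hx)
      · rcases mem_union.1 hz with hz | hz
        · exact absurd hxz.symm (hFT z hz x hx)
        · exact hD x (hFD hx) y (hFD hy) z (hFD hz) hxy hxz)
  refine ⟨I, hI, ?_⟩
  have hTF : #(T ∪ F) = #T + #F :=
    card_union_of_disjoint (hdisj.symm.mono_right hFD)
  set A := {a ∈ D | ∀ b ∈ D, ¬ G.Adj a b} with hA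
  -- `F₁` and `F₂`: free vertices whose partner is not free, respectively free
  set F₁ := {a ∈ F | ∃ b ∈ D, G.Adj a b ∧ b ∉ F} with hF₁
  set F₂ := {a ∈ F | ∃ b ∈ F, G.Adj a b} with hF₂
  set N := {a ∈ D | a ∉ F ∧ ∃ b ∈ F, G.Adj a b} with hN
  have h1 : #{x ∈ T ∪ F | ∃ y ∈ T ∪ F, G.Adj x y} ≤ #F₂ := by
    refine card_le_card fun x hx => ?_
    obtain ⟨hx, y, hy, hxy⟩ := mem_filter.1 hx
    rcases mem_union.1 hx with hx | hx <;> rcases mem_union.1 hy with hy | hy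
    · exact absurd hxy (hTT x hx y hy)
    · exact absurd hxy (hFT x hx y hy)
    · exact absurd hxy.symm (hFT y hy x hx)
    · exact mem_filter.2 ⟨hx, y, hy, hxy⟩
  have h2 : #A + #F₁ + #F₂ ≤ #F := by
    have d1 : Disjoint A F₁ := by
      refine Finset.disjoint_left.2 fun x hx hx' => ?_
      obtain ⟨-, b, hb, hxb, -⟩ := mem_filter.1 hx'
      exact (mem_filter.1 hx).2 b hb hxb
    have d2 : Disjoint (A ∪ F₁) F₂ := by
      refine Finset.disjoint_left.2 fun x hx hx' => ?_
      obtain ⟨hxF, c, hc, hxc⟩ := mem_filter.1 hx'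
      rcases mem_union.1 hx with hx | hx
      · exact (mem_filter.1 hx).2 c (hFD hc) hxc
      · obtain ⟨-, b, hb, hxb, hbF⟩ := mem_filter.1 hx
        exact hbF (hD x (hFD hxF) b hb c (hFD hc) hxb hxc ▸ hc)
    rw [← card_union_of_disjoint d1, ← card_union_of_disjoint d2]
    refine card_le_card (union_subset (union_subset ?_ (filter_subset _ _)) (filter_subset _ _))
    intro x hx
    obtain ⟨hxD, hn⟩ := mem_filter.1 hx
    refine mem_filter.2 ⟨hxD, fun t ht htx => ?_⟩
    obtain ⟨b, hb, hxb⟩ := hiso t ht x hxD htx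
    exact hn b hb hxb
  have h3 : #D ≤ #F + #N + #(blocked G D T) := by
    have : D ⊆ F ∪ N ∪ blocked G D T := by
      intro a ha
      by_cases haF : a ∈ F
      · simp [haF]
      have : ∃ t ∈ T, G.Adj t a := by
        by_contra! h
        exact haF (mem_filter.2 ⟨ha, h⟩)
      obtain ⟨t, ht, hta⟩ := this
      obtain ⟨b, hb, hab⟩ := hiso t ht a ha hta
      by_cases hbF : b ∈ F
      · exact mem_union_left _ (mem_union_right _ (mem_filter.2 ⟨ha, haF, b, hbF, hab⟩))
      · have : ∃ t ∈ T, G.Adj t b := by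
          by_contra! h
          exact hbF (mem_filter.2 ⟨hb, h⟩)
        exact mem_union_right _ (mem_filter.2 ⟨ha, b, hb, hab, ⟨t, ht, hta⟩, this⟩)
    calc #D ≤ _ := card_le_card this
      _ ≤ #(F ∪ N) + _ := card_union_le _ _
      _ ≤ _ := by gcongr; exact card_union_le _ _
  have h4 : #N ≤ #F₁ := by
    have key : ∀ a ∈ N, ∃ b ∈ F, G.Adj a b := fun a ha => (mem_filter.1 ha).2.2
    choose! p hp using key
    refine card_le_card_of_injOn p ?_ ?_
    · intro a ha
      obtain ⟨hb, hab⟩ := hp a ha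
      obtain ⟨haD, haF, -⟩ := mem_filter.1 ha
      exact mem_filter.2 ⟨hb, a, haD, hab.symm, haF⟩
    · intro a ha a' ha' he
      obtain ⟨hb, hab⟩ := hp a ha
      obtain ⟨-, hab'⟩ := hp a' ha'
      rw [← he] at hab'
      exact hD _ (hFD hb) a (mem_filter.1 ha).1 a' (mem_filter.1 ha').1 hab.symm hab'.symm
  omega

/-! ### Greedy selection along conflicts -/

/-- Two vertices outside `D` conflict if they are adjacent or if they are adjacent to different
ends of an edge inside `D`, which they would then block together. -/
def Conflict {V : Type*} (G : SimpleGraph V) (D : Finset V) (v w : V) : Prop :=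
  G.Adj v w ∨ ∃ a ∈ D, ∃ b ∈ D, G.Adj a b ∧ G.Adj v a ∧ G.Adj w b

open scoped Classical in
/-- If every vertex of `S` has six conflicts inside `S`, then `S` together with the pairs of `D`
it touches is closed under adjacency, so that `S` itself is independent and blocks few pairs. -/
theorem isIndepSet_of_six_le_conflicts {V : Type*} [Fintype V] (G : SimpleGraph V)
    (hdeg : ∀ v, #{w | G.Adj v w} = 3) (D S : Finset V)
    (hD : ∀ x ∈ D, ∀ y ∈ D, ∀ z ∈ D, G.Adj x y → G.Adj x z → y = z) (hdisj : Disjoint D S)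
    (hS : ∀ v ∈ S, 6 ≤ #{w ∈ S | G.Conflict D v w}) :
    G.IsIndepSet (S : Set V) ∧ #S + 3 * #(blocked G D S) ≤ 6 * #S := by
  -- `H a`: the neighbors in `S` of the partner of `a`
  let H : V → Finset V := fun a => {w ∈ S | ∃ b ∈ D, G.Adj a b ∧ G.Adj w b}
  have hH : ∀ a ∈ D, #(H a) ≤ 2 := by
    intro a ha
    by_cases h : ∃ b ∈ D, G.Adj a b
    · obtain ⟨b, hb, hab⟩ := h
      have hsub : H a ⊆ ({w | G.Adj b w} : Finset V).erase a := by
        intro w hw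
        obtain ⟨hwS, c, hc, hac, hwc⟩ := mem_filter.1 hw
        obtain rfl := hD a ha b hb c hc hab hac
        refine mem_erase.2 ⟨?_, by simpa using hwc.symm⟩
        rintro rfl
        exact Finset.disjoint_left.1 hdisj ha hwS
      have := card_le_card hsub
      rwa [card_erase_of_mem (by simpa using hab.symm), hdeg] at this
    · have : H a = ∅ := by
        refine filter_eq_empty_iff.2 fun w _ hw => h ?_
        obtain ⟨b, hb, hab, -⟩ := hw
        exact ⟨b, hb, hab⟩
      simp [this]
  -- each neighbor of `v` in `D` contributes at most two conflicts, any other neighbor at most one,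
  -- so six conflicts force three neighbors in `D` contributing two each
  have key : ∀ v ∈ S, ∀ a, G.Adj v a → a ∈ D ∧ #(H a) = 2 := by
    intro v hv
    set P := {a ∈ ({w | G.Adj v w} : Finset V) | a ∈ D} with hP
    set Q := {a ∈ ({w | G.Adj v w} : Finset V) | a ∉ D} with hQ
    have hPQ : #P + #Q = 3 := by
      rw [← hdeg v]; exact card_filter_add_card_filter_not _
    have hsub : {w ∈ S | G.Conflict D v w} ⊆ Q ∪ P.biUnion H := by
      intro w hw
      obtain ⟨hwS, hvw | ⟨a, ha, b, hb, hab, hva, hwb⟩⟩ := mem_filter.1 hw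
      · refine mem_union_left _ (mem_filter.2 ⟨by simpa using hvw, fun h => ?_⟩)
        exact Finset.disjoint_left.1 hdisj h hwS
      · refine mem_union_right _ (mem_biUnion.2 ⟨a, ?_, ?_⟩)
        · exact mem_filter.2 ⟨by simpa using hva, ha⟩
        · exact mem_filter.2 ⟨hwS, b, hb, hab, hwb⟩
    have h6 : 6 ≤ #Q + ∑ a ∈ P, #(H a) :=
      (hS v hv).trans <| (card_le_card hsub).trans <| (card_union_le _ _).trans <| by
        gcongr; exact card_biUnion_le
    have hsum : ∑ a ∈ P, #(H a) ≤ ∑ a ∈ P, 2 :=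
      sum_le_sum fun a ha => hH a (mem_filter.1 ha).2
    have hsum' := hsum
    rw [sum_const, smul_eq_mul] at hsum'
    have hQ0 : #Q = 0 := by omega
    intro a hva
    have haD : a ∈ D := by
      by_contra h
      rw [card_eq_zero] at hQ0
      have : a ∈ Q := mem_filter.2 ⟨by simpa using hva, h⟩
      simp [hQ0] at this
    refine ⟨haD, ?_⟩
    have heq : ∑ a ∈ P, #(H a) = ∑ a ∈ P, 2 := by
      rw [sum_const, smul_eq_mul]; omega
    exact (sum_eq_sum_iff_of_le fun a ha => hH a (mem_filter.1 ha).2).1 heq a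
      (mem_filter.2 ⟨by simpa using hva, haD⟩)
  refine ⟨fun v hv w hw _ hvw => Finset.disjoint_left.1 hdisj (key v hv w hvw).1 hw, ?_⟩
  have h2 : ∀ a ∈ blocked G D S, 2 ≤ #{v ∈ S | G.Adj a v} := by
    intro a ha
    obtain ⟨haD, b, hb, hab, -, t, ht, htb⟩ := mem_filter.1 ha
    rw [← (key t ht b htb).2]
    refine card_le_card fun w hw => ?_
    obtain ⟨hwS, c, hc, hbc, hwc⟩ := mem_filter.1 hw
    obtain rfl := hD b hb a haD c hc hab.symm hbc
    exact mem_filter.2 ⟨hwS, hwc.symm⟩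
  have hcount : #(blocked G D S) * 2 ≤ #S * 3 := by
    refine card_mul_le_card_mul G.Adj h2 fun v _ => ?_
    rw [← hdeg v]
    refine card_le_card fun w hw => ?_
    simpa using (mem_filter.1 hw).2.symm
  omega

open scoped Classical in
/-- Greedy selection: a vertex with at most five conflicts is taken and its conflicts are
discarded, and by the lack of triangles it blocks no further pair. The
coefficient `3` is `6 / 2`, as `blocked` counts both ends of a pair. -/
theorem exists_subset_blocked {V : Type*} [Fintype V] (G : SimpleGraph V)
    (hdeg : ∀ v, #{w | G.Adj v w} = 3) (htri : ∀ x y z, G.Adj x y → G.Adj y z → ¬ G.Adj x z)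
    (D : Finset V) (hD : ∀ x ∈ D, ∀ y ∈ D, ∀ z ∈ D, G.Adj x y → G.Adj x z → y = z)
    (S : Finset V) (hdisj : Disjoint D S) :
    ∃ T ⊆ S, G.IsIndepSet (T : Set V) ∧ #S + 3 * #(blocked G D T) ≤ 6 * #T := by
  induction S using Finset.strongInduction with
  | H S ih =>
  by_cases h : ∀ v ∈ S, 6 ≤ #{w ∈ S | G.Conflict D v w}
  · exact ⟨S, Subset.rfl, isIndepSet_of_six_le_conflicts G hdeg D S hD hdisj h⟩
  push Not at h
  obtain ⟨v, hv, hlt⟩ := h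
  set C := insert v {w ∈ S | G.Conflict D v w} with hC
  have hCS : C ⊆ S := insert_subset hv (filter_subset _ _)
  have hvC : v ∈ C := mem_insert_self _ _
  have hCcard : #C ≤ 6 := (card_insert_le _ _).trans (by omega)
  obtain ⟨T, hTS, hT, hle⟩ := ih (S \ C)
    (Finset.ssubset_iff_subset_ne.2 ⟨sdiff_subset, fun he => by
      have := he ▸ hv
      exact (mem_sdiff.1 this).2 hvC⟩) (hdisj.mono_right sdiff_subset)
  have hno : ∀ t ∈ T, ¬ G.Conflict D v t := fun t ht hc => by
    obtain ⟨h1, h2⟩ := mem_sdiff.1 (hTS ht)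
    exact h2 (mem_insert_of_mem (mem_filter.2 ⟨h1, hc⟩))
  have hvT : v ∉ T := fun h => (mem_sdiff.1 (hTS h)).2 hvC
  refine ⟨insert v T, insert_subset hv (hTS.trans sdiff_subset), ?_, ?_⟩
  · rw [coe_insert]
    refine Set.Pairwise.insert hT fun t ht _ => ?_
    have : ¬ G.Adj v t := fun h => hno t ht (Or.inl h)
    exact ⟨this, fun h => this h.symm⟩
  · have hbl : blocked G D (insert v T) ⊆ blocked G D T := by
      intro a ha
      obtain ⟨haD, b, hb, hab, ⟨s, hs, hsa⟩, t, ht, htb⟩ := mem_filter.1 ha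
      refine mem_filter.2 ⟨haD, b, hb, hab, ?_⟩
      rcases mem_insert.1 hs with hsv | hs' <;> rcases mem_insert.1 ht with htv | ht'
      · exact absurd (htv ▸ htb) (htri _ _ _ (hsv ▸ hsa) hab)
      · exact absurd (Or.inr ⟨a, haD, b, hb, hab, hsv ▸ hsa, htb⟩) (hno t ht')
      · exact absurd (Or.inr ⟨b, hb, a, haD, hab.symm, htv ▸ htb, hsa⟩) (hno s hs')
      · exact ⟨⟨s, hs', hsa⟩, t, ht', htb⟩
    have := card_le_card hbl
    have := card_sdiff_add_card_eq_card hCS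
    rw [card_insert_of_notMem hvT]
    omega

/-! ### An extremal dissociation set -/

open scoped Classical in
theorem sum_card_adj_of_dissociation {V : Type*} (G : SimpleGraph V) (X : Finset V)
    (hX : ∀ x ∈ X, ∀ y ∈ X, ∀ z ∈ X, G.Adj x y → G.Adj x z → y = z) :
    ∑ x ∈ X, #{y ∈ X | G.Adj x y} = #{x ∈ X | ∃ y ∈ X, G.Adj x y} := by
  rw [card_filter]
  refine sum_congr rfl fun x hx => ?_
  split_ifs with h
  · obtain ⟨y, hy, hxy⟩ := h
    refine card_eq_one.2 ⟨y, ?_⟩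
    ext z
    simp only [mem_filter, mem_singleton]
    exact ⟨fun hz => hX x hx z hz.1 y hy hz.2 hxy, fun hz => hz ▸ ⟨hy, hxy⟩⟩
  · refine card_eq_zero.2 (filter_eq_empty_iff.2 fun y hy hxy => h ⟨y, hy, hxy⟩)

open scoped Classical in
theorem isDissociationSet_coe_iff {V : Type*} (G : SimpleGraph V) (D : Finset V) :
    G.IsDissociationSet (D : Set V) ↔
      ∀ x ∈ D, ∀ y ∈ D, ∀ z ∈ D, G.Adj x y → G.Adj x z → y = z := by
  unfold IsDissociationSet
  simp only [Set.encard_le_one_iff, mem_neighborSet, comap_adj, Function.Embedding.subtype_apply,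
    Subtype.forall, mem_coe, Subtype.mk.injEq]

open scoped Classical in
theorem dissociation_insert {V : Type*} (G : SimpleGraph V) {D : Finset V} (v : V)
    (hD : ∀ x ∈ D, ∀ y ∈ D, ∀ z ∈ D, G.Adj x y → G.Adj x z → y = z)
    (huniq : ∀ a ∈ D, ∀ b ∈ D, G.Adj v a → G.Adj v b → a = b)
    (hiso : ∀ a ∈ D, G.Adj v a → ∀ b ∈ D, ¬ G.Adj a b) :
    ∀ x ∈ insert v D, ∀ y ∈ insert v D, ∀ z ∈ insert v D, G.Adj x y → G.Adj x z → y = z := by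
  simp only [forall_mem_insert]
  refine ⟨⟨⟨fun h => absurd h G.irrefl, fun _ _ h => absurd h G.irrefl⟩, fun y hy =>
    ⟨fun _ h => absurd h G.irrefl, fun z hz h h' => huniq y hy z hz h h'⟩⟩, fun x hx =>
    ⟨⟨fun _ _ => trivial, fun z hz h h' => absurd h' (hiso x hx h.symm z hz)⟩, fun y hy =>
    ⟨fun h h' => absurd h (hiso x hx h'.symm y hy), hD x hx y hy⟩⟩⟩

open scoped Classical in
/-- A maximum dissociation set with as many isolated vertices as possible: adding a vertex `v`
with at most one neighbor `a` in `D`, or exchanging `a` for `v` if `a` has a partner in `D`,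
would give a better one. -/
theorem exists_dissociation_dominating {V : Type*} [Fintype V] (G : SimpleGraph V) :
    ∃ D : Finset V, (∀ x ∈ D, ∀ y ∈ D, ∀ z ∈ D, G.Adj x y → G.Adj x z → y = z) ∧
      #D = G.dissNum ∧ ∀ v ∉ D, 2 ≤ #{a ∈ D | G.Adj v a} := by
  have hbdd : BddAbove {n | ∃ D : Finset V, G.IsDissociationSet (D : Set V) ∧ #D = n} :=
    ⟨Fintype.card V, by rintro n ⟨D, -, rfl⟩; exact card_le_univ D⟩
  have hmem : G.dissNum ∈ {n | ∃ D : Finset V, G.IsDissociationSet (D : Set V) ∧ #D = n} :=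
    Nat.sSup_mem ⟨0, ∅, (isDissociationSet_coe_iff G ∅).2 (by simp), rfl⟩ hbdd
  obtain ⟨D₀, hD₀, hc₀⟩ := hmem
  obtain ⟨D, hDm, hmax⟩ := exists_max_image
    ({D | G.IsDissociationSet (D : Set V) ∧ #D = G.dissNum} : Finset (Finset V))
    (fun D => #{a ∈ D | ∀ b ∈ D, ¬ G.Adj a b}) ⟨D₀, by simp [hD₀, hc₀]⟩
  simp only [mem_filter, mem_univ, true_and] at hDm hmax
  obtain ⟨hDd, hcard⟩ := hDm
  have hD := (isDissociationSet_coe_iff G D).1 hDd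
  refine ⟨D, hD, hcard, fun v hv => ?_⟩
  by_contra! hlt
  have huniq : ∀ a ∈ D, ∀ b ∈ D, G.Adj v a → G.Adj v b → a = b := by
    intro a ha b hb hva hvb
    exact card_le_one.1 (Nat.le_of_lt_succ hlt) a (mem_filter.2 ⟨ha, hva⟩) b
      (mem_filter.2 ⟨hb, hvb⟩)
  by_cases h : ∃ a ∈ D, G.Adj v a ∧ ∃ b ∈ D, G.Adj a b
  · obtain ⟨a, ha, hva, b, hb, hab⟩ := h
    have hv' : v ∉ D.erase a := fun h => hv (mem_of_mem_erase h)
    have hvn : ∀ x ∈ D.erase a, ¬ G.Adj v x := fun x hx hvx =>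
      (mem_erase.1 hx).1 (huniq x (mem_of_mem_erase hx) a ha hvx hva)
    have hd' : G.IsDissociationSet ((insert v (D.erase a) : Finset V) : Set V) := by
      rw [isDissociationSet_coe_iff]
      exact dissociation_insert G v (fun x hx y hy z hz => hD x (mem_of_mem_erase hx) y
        (mem_of_mem_erase hy) z (mem_of_mem_erase hz)) (fun x hx _ _ hvx => absurd hvx (hvn x hx))
        fun x hx hvx => absurd hvx (hvn x hx)
    have hc' : #(insert v (D.erase a)) = G.dissNum := by
      rw [card_insert_of_notMem hv', card_erase_add_one ha, hcard]
    have := hmax _ ⟨hd', hc'⟩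
    refine absurd this (not_le.2 (card_lt_card ?_))
    rw [ssubset_iff_of_subset]
    · refine ⟨v, mem_filter.2 ⟨mem_insert_self _ _, fun x hx => ?_⟩, fun h => hv (mem_filter.1 h).1⟩
      rcases mem_insert.1 hx with rfl | hx
      · exact G.irrefl
      · exact hvn x hx
    · intro x hx
      obtain ⟨hxD, hxn⟩ := mem_filter.1 hx
      have hxa : x ≠ a := by rintro rfl; exact hxn b hb hab
      have hx' := mem_erase.2 ⟨hxa, hxD⟩
      refine mem_filter.2 ⟨mem_insert_of_mem hx', fun y hy => ?_⟩
      rcases mem_insert.1 hy with rfl | hy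
      · exact fun h => hvn x hx' h.symm
      · exact hxn y (mem_of_mem_erase hy)
  · push Not at h
    have hd' : G.IsDissociationSet ((insert v D : Finset V) : Set V) := by
      rw [isDissociationSet_coe_iff]
      exact dissociation_insert G v hD huniq h
    have : #(insert v D) ≤ G.dissNum := le_csSup hbdd ⟨_, hd', rfl⟩
    rw [card_insert_of_notMem hv] at this
    omega

end SimpleGraph

/-! ### The combination of the two bounds -/

open Finset in
open scoped Classical in
theorem mainTheorem6 {V : Type*} [Finite V] (G : SimpleGraph V) [G.LocallyFinite]
    (hcubic : G.IsRegularOfDegree 3) (htriangle : G.CliqueFree 3) :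
    (G.indepNum : ℝ) ≥ (5 / 8 : ℝ) * (G.dissNum : ℝ) := by
  have := Fintype.ofFinite V
  have hdeg : ∀ v, #{w | G.Adj v w} = 3 := fun v => by
    rw [← hcubic v, ← G.card_neighborFinset_eq_degree]
    congr 1
    ext w
    simp
  have htri : ∀ x y z, G.Adj x y → G.Adj y z → ¬ G.Adj x z := fun x y z hxy hyz hxz =>
    htriangle {x, y, z} (SimpleGraph.is3Clique_triple_iff.2 ⟨hxy, hxz, hyz⟩)
  obtain ⟨D, hD, hcard, hdom⟩ := G.exists_dissociation_dominating
  have hsplit : ∀ v, #{a ∈ Dᶜ | G.Adj v a} + #{a ∈ D | G.Adj v a} = 3 := fun v => by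
    rw [← hdeg v, add_comm, ← card_union_of_disjoint, ← filter_union, union_compl]
    exact disjoint_filter_filter disjoint_compl_right
  have hR : ∀ x ∈ Dᶜ, ∀ y ∈ Dᶜ, ∀ z ∈ Dᶜ, G.Adj x y → G.Adj x z → y = z := by
    intro x hx y hy z hz hxy hxz
    have h1 := hsplit x
    have h2 := hdom x (mem_compl.1 hx)
    exact card_le_one.1 (by omega : #{a ∈ Dᶜ | G.Adj x a} ≤ 1) y (mem_filter.2 ⟨hy, hxy⟩) z
      (mem_filter.2 ⟨hz, hxz⟩)
  have hα : ∀ I : Finset V, G.IsIndepSet (I : Set V) → #I ≤ G.indepNum :=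
    fun I hI => hI.card_le_indepNum
  -- the number of edges between `D` and its complement, counted from both sides
  have hcount : 3 * #Dᶜ + #{x ∈ D | ∃ y ∈ D, G.Adj x y} =
      3 * #D + #{x ∈ Dᶜ | ∃ y ∈ Dᶜ, G.Adj x y} := by
    rw [← G.sum_card_adj_of_dissociation D hD, ← G.sum_card_adj_of_dissociation _ hR]
    have h1 : ∑ x ∈ D, (#{y ∈ Dᶜ | G.Adj x y} + #{y ∈ D | G.Adj x y}) = 3 * #D := by
      simp [hsplit, mul_comm]
    have h2 : ∑ x ∈ Dᶜ, (#{y ∈ Dᶜ | G.Adj x y} + #{y ∈ D | G.Adj x y}) = 3 * #Dᶜ := by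
      simp only [hsplit, sum_const, smul_eq_mul, mul_comm]
    have h3 : ∑ x ∈ D, #{y ∈ Dᶜ | G.Adj x y} = ∑ x ∈ Dᶜ, #{y ∈ D | G.Adj x y} := by
      have := sum_card_bipartiteAbove_eq_sum_card_bipartiteBelow (s := D) (t := Dᶜ) G.Adj
      simpa only [bipartiteAbove, bipartiteBelow, G.adj_comm] using this
    rw [sum_add_distrib] at h1 h2
    omega
  set A := {a ∈ D | ∀ b ∈ D, ¬ G.Adj a b} with hA
  have hDA : #{x ∈ D | ∃ y ∈ D, G.Adj x y} + #A = #D := by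
    rw [← card_filter_add_card_filter_not (s := D) (fun x => ∃ y ∈ D, G.Adj x y)]
    simp only [hA, not_exists, not_and]
  obtain ⟨I, -, hI, hIc⟩ := G.exists_isIndepSet_of_dissociation _ hR
  set U := {v ∈ Dᶜ | ∀ a ∈ A, ¬ G.Adj v a} with hU
  have hUc : #Dᶜ ≤ #U + #A * 3 := by
    have hsub : Dᶜ ⊆ U ∪ A.biUnion fun a => {w | G.Adj a w} := by
      intro v hv
      by_cases h : ∀ a ∈ A, ¬ G.Adj v a
      · exact mem_union_left _ (mem_filter.2 ⟨hv, h⟩)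
      · push Not at h
        obtain ⟨a, ha, hva⟩ := h
        exact mem_union_right _ (mem_biUnion.2 ⟨a, ha, by simpa using hva.symm⟩)
    refine (card_le_card hsub).trans ((card_union_le _ _).trans ?_)
    gcongr
    exact card_biUnion_le_card_mul _ _ _ fun a _ => (hdeg a).le
  have hDU : Disjoint D U := disjoint_compl_right.mono_right (filter_subset _ _)
  obtain ⟨T, hTU, hT, hTc⟩ := G.exists_subset_blocked hdeg htri D hD U hDU
  obtain ⟨J, hJ, hJc⟩ := G.exists_isIndepSet_of_blocked D T hD hT (hDU.mono_right hTU) (by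
    intro t ht a ha hta
    by_contra! h
    exact (mem_filter.1 (hTU ht)).2 a (mem_filter.2 ⟨ha, h⟩) hta)
  have hJA : 2 * #T + #D + #A ≤ 2 * #J + #(G.blocked D T) := by convert hJc
  have hIα := hα I hI
  have hJα := hα J hJ
  have hfin : 5 * G.dissNum ≤ 8 * G.indepNum := by
    -- three times the sum of `hIc`, `hTc` and `3 * hJA`, with `hcount` and `hUc` substituted
    rw [← hcard]
    omega
  have : (5 * G.dissNum : ℝ) ≤ 8 * G.indepNum := by exact_mod_cast hfin
  linarith
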